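/- A bigraphon $(J_1,J_2,W)$ consists of probability spaces $(J_1,\pi_1)$, $(J_2,\pi_2)$ and a measurable function $W:J_1\times J_2\to[0,1]$ (measurability with respect to the completion of $\pi_1\times\pi_2$ suffices). It is pure if all sections $W(x,\cdot)$ and $W(\cdot,y)$ are integrable, the neighborhood distances $$r_1(x,x')=\int_{J_2}|W(x,z)-W(x',z)|\,d\pi_2(z),\qquad r_2(y,y')=\int_{J_1}|W(z,y)-W(z,y')|\,d\pi_1(z)$$ make $J_1$ and $J_2$ complete separable metric spaces (in particular distinct points have positive distance), and every nonempty open subset of $(J_i,r_i)$ has positive $\pi_i$-measure ($i=1,2$). A bigraph is a triple $F=(U_1,U_2,E)$ with $U_1,U_2$ finite sets and $E\subseteq U_1\times U_2$; it has $|U_1|+|U_2|$ nodes. Its induced density in $W$ is $$t^{\mathsf b}_{\mathrm{ind}}(F,W)=\int_{J_1^{U_1}}\int_{J_2^{U_2}}\ \prod_{ij\in E}W(x_i,y_j)\prod_{ij\in (U_1\times U_2)\setminus E}\bigl(1-W(x_i,y_j)\bigr)\,dy\,dx .$$ The bigraphon is thin if $t^{\mathsf b}_{\mathrm{ind}}(F,W)=0$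 for some bigraph $F$. The (upper) packing dimension of a metric space is $\limsup_{\varepsilon\to0^+}\log N(\varepsilon)/\log(1/\varepsilon)$, where $N(\varepsilon)\in\mathbb N\cup\{\infty\}$ is the maximum number of points mutually at distance at least $\varepsilon$. **Theorem.** Let $(J_1,J_2,W)$ be a pure bigraphon that is thin. Then (a) $W(x,y)\in\{0,1\}$ for almost all $(x,y)\in J_1\times J_2$; (b) the metric spaces $(J_1,r_1)$ and $(J_2,r_2)$ are compact; (c) $(J_1,r_1)$ and $(J_2,r_2)$ have finite packing dimension; moreover, for every bigraph $F$ with $t^{\mathsf b}_{\mathrm{ind}}(F,W)=0$, both packing dimensions are at most $10k$, where $k$ is the number of nodes of $F$. -/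

import Mathlib

open MeasureTheory Filter Topology

/-- A bigraph `(U₁, U₂, E)`: finite sets `U₁`, `U₂` and an edge set `E ⊆ U₁ × U₂`. -/
structure Bigraph where
  U₁ : Type
  U₂ : Type
  [fintype₁ : Fintype U₁]
  [fintype₂ : Fintype U₂]
  E : Finset (U₁ × U₂)

attribute [instance] Bigraph.fintype₁ Bigraph.fintype₂

/-- The number of nodes of a bigraph. -/
def Bigraph.numNodes (F : Bigraph) : ℕ := Fintype.card F.U₁ + Fintype.card F.U₂

/-- `W` is a bigraphon on the probability spaces `(J₁, π₁)` and `(J₂, π₂)`: a `[0,1]`-valued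
function that is measurable with respect to the completion of the product measure (in particular
every jointly measurable function is allowed). -/
structure IsBigraphon {J₁ J₂ : Type*} [MeasurableSpace J₁] [MeasurableSpace J₂]
    (π₁ : Measure J₁) (π₂ : Measure J₂) (W : J₁ → J₂ → ℝ) : Prop where
  aemeasurable : AEMeasurable (Function.uncurry W) (π₁.prod π₂)
  mem_Icc : ∀ x y, W x y ∈ Set.Icc (0 : ℝ) 1

/-- The neighborhood distance `r₁(x, x') = ‖W(x,·) - W(x',·)‖₁` on `J₁`. -/
noncomputable def nbhdDist₁ {J₁ J₂ : Type*} [MeasurableSpace J₂] (π₂ : Measure J₂)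
    (W : J₁ → J₂ → ℝ) (x x' : J₁) : ℝ :=
  ∫ z, |W x z - W x' z| ∂π₂

/-- The neighborhood distance `r₂(y, y') = ‖W(·,y) - W(·,y')‖₁` on `J₂`. -/
noncomputable def nbhdDist₂ {J₁ J₂ : Type*} [MeasurableSpace J₁] (π₁ : Measure J₁)
    (W : J₁ → J₂ → ℝ) (y y' : J₂) : ℝ :=
  ∫ z, |W z y - W z y'| ∂π₁

/-- The bigraphon `W` is pure. The metric structures on `J₁` and `J₂` are those given by the
neighborhood distances `r₁` and `r₂` (which therefore separate points); these distances are defined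
for all pairs of points, that is, every section of `W` is an `L₁` function; both metric spaces are
complete and separable, and every nonempty open set has positive measure. -/
structure IsPureBigraphon {J₁ J₂ : Type*} [MeasurableSpace J₁] [MeasurableSpace J₂]
    [MetricSpace J₁] [MetricSpace J₂]
    (π₁ : Measure J₁) (π₂ : Measure J₂) (W : J₁ → J₂ → ℝ) : Prop
    extends IsBigraphon π₁ π₂ W where
  section₁ : ∀ x, AEMeasurable (fun y => W x y) π₂
  section₂ : ∀ y, AEMeasurable (fun x => W x y) π₁
  dist_eq₁ : ∀ x x' : J₁, dist x x' = nbhdDist₁ π₂ W x x'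
  dist_eq₂ : ∀ y y' : J₂, dist y y' = nbhdDist₂ π₁ W y y'
  complete₁ : CompleteSpace J₁
  complete₂ : CompleteSpace J₂
  separable₁ : TopologicalSpace.SeparableSpace J₁
  separable₂ : TopologicalSpace.SeparableSpace J₂
  full_support₁ : ∀ U : Set J₁, IsOpen U → U.Nonempty → 0 < π₁ U
  full_support₂ : ∀ U : Set J₂, IsOpen U → U.Nonempty → 0 < π₂ U

open Classical in
/-- The induced density of the bigraph `F` at a given choice `x, y` of the node variables:
`∏_{ij ∈ E} W(x_i, y_j) ∏_{ij ∉ E} (1 - W(x_i, y_j))`. -/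
noncomputable def inducedDensityAt {J₁ J₂ : Type*} (F : Bigraph) (W : J₁ → J₂ → ℝ)
    (x : F.U₁ → J₁) (y : F.U₂ → J₂) : ℝ :=
  (∏ p ∈ F.E, W (x p.1) (y p.2)) * ∏ p ∈ F.Eᶜ, (1 - W (x p.1) (y p.2))

/-- The induced density of the bigraph `F` in the bigraphon `W`. -/
noncomputable def inducedDensity {J₁ J₂ : Type*} [MeasurableSpace J₁] [MeasurableSpace J₂]
    (π₁ : Measure J₁) (π₂ : Measure J₂) (F : Bigraph) (W : J₁ → J₂ → ℝ) : ℝ :=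
  ∫ x : F.U₁ → J₁, ∫ y : F.U₂ → J₂, inducedDensityAt F W x y
    ∂(Measure.pi fun _ => π₂) ∂(Measure.pi fun _ => π₁)

/-- A bigraphon is thin if some bigraph has induced density `0` in it. -/
def IsThin {J₁ J₂ : Type*} [MeasurableSpace J₁] [MeasurableSpace J₂]
    (π₁ : Measure J₁) (π₂ : Measure J₂) (W : J₁ → J₂ → ℝ) : Prop :=
  ∃ F : Bigraph, inducedDensity π₁ π₂ F W = 0

/-- `N(ε)`: the supremum of the cardinalities of finite sets of points of `M` that are mutually at
distance at least `ε`. -/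
noncomputable def sepNumber (M : Type*) [MetricSpace M] (ε : ℝ) : ℕ∞ :=
  ⨆ (s : Finset M) (_ : (s : Set M).Pairwise fun x y => ε ≤ dist x y), (s.card : ℕ∞)

/-- The upper packing dimension `limsup_{ε → 0+} log N(ε) / log (1/ε)`, an extended real. -/
noncomputable def upperPackingDim (M : Type*) [MetricSpace M] : EReal :=
  limsup (fun ε : ℝ => ENNReal.log (sepNumber M ε : ENNReal) / (Real.log (1 / ε) : EReal)) (𝓝[>] 0)

/-!
Sample `M` random columns. Two rows at distance at least `ε` agree on all of them with probability
at most `(1 - ε) ^ M`, so when `M` is of order `ε⁻¹ log n` the `n` rows of some `ε`-separated set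
become distinct on the sample. Almost surely the sampled matrix has entries in `{0, 1}`: if `W` were
strictly between `0` and `1` on a set of positive measure, a random grid would lie in that set with
positive probability, and every bigraph would have positive density. Almost surely the sample also
contains no induced copy of `F`. The full support of `π₁` allows the rows themselves to be replaced
by nearby generic ones. By the Sauer–Shelah lemma a `{0, 1}`-matrix with `n` distinct rows and `M`
columns that contains no induced copy of a bigraph on `k` nodes has `n ≤ (M + 1) ^ k`. Hence
`log n ≤ k (log (1 / ε) + log log n + O(1))`, which bounds the packing dimension by `k`. A space of
finite packing dimension is totally bounded, so completeness gives compactness.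
-/

section Combinatorics

open Finset

theorem sum_choose_le_pow (n k : ℕ) : ∑ i ∈ Iic k, n.choose i ≤ (n + 1) ^ k := by
  rw [← Nat.range_succ_eq_Iic, add_pow]
  refine sum_le_sum fun i hi => ?_
  have hpos : 0 < k.choose i := Nat.choose_pos (Nat.lt_succ_iff.1 (mem_range.1 hi))
  simpa using (n.choose_le_pow i).trans (Nat.le_mul_of_pos_right _ hpos)

/-- `F` is an induced sub-bigraph of the incidence bigraph of the family of sets `R`, distinct
nodes of `F` being represented by distinct members and distinct points of the family. -/
def Bigraph.IsInducedIn (F : Bigraph) {ι α : Type*} (R : ι → Finset α) : Prop :=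
  ∃ (f : F.U₁ ↪ ι) (g : F.U₂ ↪ α), ∀ u v, g v ∈ R (f u) ↔ (u, v) ∈ F.E

variable {F : Bigraph} {ι α : Type*} [Fintype ι] {R : ι → Finset α}

-- The points of the shattered set indexed by `U₁` serve only to make the chosen members distinct.
theorem Bigraph.isInducedIn_of_shatters [DecidableEq α] {s : Finset α}
    (hs : (univ.image R).Shatters s) (hcard : F.numNodes ≤ #s) : F.IsInducedIn R := by
  classical
  have hcard' : Fintype.card (F.U₁ ⊕ F.U₂) ≤ Fintype.card s := by
    simpa [Bigraph.numNodes] using hcard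
  obtain ⟨e⟩ := Function.Embedding.nonempty_of_card_le hcard'
  let trace (u : F.U₁) : Finset α :=
    {a ∈ s | a = e (.inl u) ∨ ∃ v, (u, v) ∈ F.E ∧ a = e (.inr v)}
  have htrace (u : F.U₁) : ∃ i, s ∩ R i = trace u := by
    simpa [mem_image] using hs (filter_subset _ _ : trace u ⊆ s)
  choose f hf using htrace
  have mem_R (u : F.U₁) (a : s) :
      (a : α) ∈ R (f u) ↔ a = e (.inl u) ∨ ∃ v, (u, v) ∈ F.E ∧ a = e (.inr v) := by
    simpa [trace] using Finset.ext_iff.1 (hf u) a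
  have hf_inj : Function.Injective f := fun u u' h => by
    have hmem := (mem_R u (e (.inl u))).2 (.inl rfl)
    rw [h, mem_R] at hmem
    simpa using hmem
  exact ⟨⟨f, hf_inj⟩, (Function.Embedding.inr.trans e).trans (.subtype _), by simp [mem_R]⟩

theorem Bigraph.card_le_of_not_isInducedIn [Fintype α] (hR : Function.Injective R)
    (hF : ¬ F.IsInducedIn R) :
    Fintype.card ι ≤ (Fintype.card α + 1) ^ F.numNodes := by
  classical
  have hvc : (univ.image R).vcDim ≤ F.numNodes := Finset.sup_le fun s hs =>
    le_of_not_ge fun hcard => hF (isInducedIn_of_shatters (mem_shatterer.1 hs) hcard)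
  calc Fintype.card ι = #(univ.image R) := by rw [card_image_of_injective _ hR, card_univ]
    _ ≤ #(univ.image R).shatterer := card_le_card_shatterer _
    _ ≤ ∑ i ∈ Iic (univ.image R).vcDim, (Fintype.card α).choose i := card_shatterer_le_sum_vcDim
    _ ≤ ∑ i ∈ Iic F.numNodes, (Fintype.card α).choose i :=
        sum_le_sum_of_subset (Iic_subset_Iic.2 hvc)
    _ ≤ (Fintype.card α + 1) ^ F.numNodes := sum_choose_le_pow _ _

end Combinatorics

section Sampling

variable {α β ι κ : Type*} [Fintype ι] [Fintype κ] [MeasurableSpace α] [MeasurableSpace β]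
  {μ : Measure α} {ν : Measure β}

theorem ae_prod_swap [SFinite μ] [SFinite ν] {p : α × β → Prop} (h : ∀ᵐ q ∂(μ.prod ν), p q) :
    ∀ᵐ q ∂(ν.prod μ), p q.swap :=
  Measure.measurePreserving_swap.quasiMeasurePreserving.ae h

theorem ae_notMem_of_ae_not_forall_snd_mem [SigmaFinite ν] {S : Set (α × β)}
    (hS : MeasurableSet S)
    (h : ∀ᵐ p : α × (κ → β) ∂(μ.prod (Measure.pi fun _ => ν)), ¬ ∀ j, (p.1, p.2 j) ∈ S) :
    ∀ᵐ p ∂(μ.prod ν), p ∉ S := by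
  rw [← measure_eq_zero_iff_ae_notMem, Measure.measure_prod_null hS]
  filter_upwards [Measure.ae_ae_of_ae_prod h] with a ha
  have hpi : {y : κ → β | ∀ j, (a, y j) ∈ S} = Set.univ.pi fun _ => Prod.mk a ⁻¹' S := by
    ext y; simp
  simp only [ae_iff, not_not, hpi, Measure.pi_pi, Finset.prod_const] at ha
  exact eq_zero_of_pow_eq_zero ha

-- Being a grid inside `S` is a power of a set in each of the two variables in turn, and a power
-- of a set is null only if the set is.
theorem ae_notMem_of_ae_not_forall_mem [SigmaFinite μ] [SigmaFinite ν] {S : Set (α × β)}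
    (hS : NullMeasurableSet S (μ.prod ν))
    (h : ∀ᵐ p : (ι → α) × (κ → β) ∂((Measure.pi fun _ => μ).prod (Measure.pi fun _ => ν)),
      ¬ ∀ i j, (p.1 i, p.2 j) ∈ S) :
    ∀ᵐ p ∂(μ.prod ν), p ∉ S := by
  obtain ⟨T, hTS, hT, hTS_ae⟩ := hS.exists_measurable_subset_ae_eq
  have hstar : MeasurableSet {q : (κ → β) × α | ∀ j, (q.2, q.1 j) ∈ T} := by
    rw [Set.ofPred_forall]
    exact .iInter fun j => hT.preimage (by fun_prop)
  have hstar_ae : ∀ᵐ q ∂((Measure.pi fun _ : κ => ν).prod μ), ¬ ∀ j, (q.2, q.1 j) ∈ T :=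
    ae_notMem_of_ae_not_forall_snd_mem (κ := ι) hstar <| (ae_prod_swap h).mono fun _ hq hall =>
      hq fun i j => hTS (hall i j)
  filter_upwards [ae_notMem_of_ae_not_forall_snd_mem hT (ae_prod_swap hstar_ae), hTS_ae.mem_iff]
    with p hpT hp hpS
  exact hpT (hp.2 hpS)

variable [IsProbabilityMeasure μ] [IsProbabilityMeasure ν]

theorem measurePreserving_pi_comp_embedding (f : ι ↪ κ) :
    MeasurePreserving (fun x : κ → α => x ∘ f) (Measure.pi fun _ => μ) (Measure.pi fun _ => μ) := by
  have hindep : ProbabilityTheory.iIndepFun (fun i (x : κ → α) => x (f i))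
      (Measure.pi fun _ => μ) :=
    (ProbabilityTheory.iIndepFun_pi (X := fun _ => id)
      fun _ => aemeasurable_id).precomp f.injective
  rw [ProbabilityTheory.iIndepFun_iff_map_fun_eq_pi_map
    fun _ => (measurable_pi_apply _).aemeasurable] at hindep
  refine ⟨by fun_prop, hindep.trans ?_⟩
  simp only [fun i => (measurePreserving_eval (fun _ : κ => μ) (f i)).map_eq]

theorem measurePreserving_eval_prodMap_eval (i : ι) (j : κ) :
    MeasurePreserving (fun p : (ι → α) × (κ → β) => (p.1 i, p.2 j))
      ((Measure.pi fun _ => μ).prod (Measure.pi fun _ => ν)) (μ.prod ν) :=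
  (measurePreserving_eval (fun _ => μ) i).prod (measurePreserving_eval (fun _ => ν) j)

theorem frequently_injective_sample {γ : Type*} {f : ι → β → γ} {q : ℝ} (hq : 0 ≤ q)
    (hf : Pairwise fun i i' => ν.real {z | f i z = f i' z} ≤ q)
    (hcard : (Fintype.card ι : ℝ) ^ 2 * q ^ Fintype.card κ < 1) :
    ∃ᵐ y : κ → β ∂(Measure.pi fun _ => ν), Function.Injective fun i j => f i (y j) := by
  classical
  let collision (p : ι × ι) : Set (κ → β) := Set.univ.pi fun _ => {z | f p.1 z = f p.2 z}
  have hcollision : ∀ p ∈ Finset.univ.offDiag,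
      (Measure.pi fun _ : κ => ν).real (collision p) ≤ q ^ Fintype.card κ := fun p hp => by
    rw [measureReal_def, Measure.pi_pi, Finset.prod_const, ENNReal.toReal_pow]
    exact pow_le_pow_left₀ measureReal_nonneg (hf (Finset.mem_offDiag.1 hp).2.2) _
  have hbad : (Measure.pi fun _ : κ => ν).real (⋃ p ∈ Finset.univ.offDiag, collision p) < 1 :=
    calc _ ≤ ∑ p ∈ Finset.univ.offDiag, (Measure.pi fun _ : κ => ν).real (collision p) :=
          measureReal_biUnion_finset_le _ _
      _ ≤ Finset.card (Finset.univ.offDiag : Finset (ι × ι)) • q ^ Fintype.card κ :=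
          Finset.sum_le_card_nsmul _ _ _ hcollision
      _ ≤ (Fintype.card ι : ℝ) ^ 2 * q ^ Fintype.card κ := by
          rw [nsmul_eq_mul]
          gcongr
          exact_mod_cast (Finset.offDiag_card _).trans_le ((Nat.sub_le _ _).trans_eq (sq _).symm)
      _ < 1 := hcard
  intro hnot
  refine hbad.ne ((measureReal_congr (eventuallyEq_univ.2 ?_)).trans probReal_univ)
  filter_upwards [hnot] with y hy
  simp only [Function.Injective, not_forall] at hy
  obtain ⟨i, i', heq, hne⟩ := hy
  exact Set.mem_biUnion (x := (i, i')) (by simpa using hne) fun j _ => congrFun heq j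

theorem measureReal_eq_zero_le_one_sub_integral {f : β → ℝ} (hf : Integrable f ν)
    (hf_le : ∀ z, f z ≤ 1) : ν.real {z | f z = 0} ≤ 1 - ∫ z, f z ∂ν :=
  calc ν.real {z | f z = 0}
    _ ≤ ν.real {z | 1 ≤ 1 - f z} := measureReal_mono fun z (hz : f z = 0) => by simp [hz]
    _ ≤ ∫ z, (1 - f z) ∂ν := by
        simpa using mul_meas_ge_le_integral_of_nonneg (.of_forall fun z => sub_nonneg.2 (hf_le z))
          ((integrable_const 1).sub hf) 1
    _ = 1 - ∫ z, f z ∂ν := by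
        rw [integral_sub (integrable_const 1) hf, integral_const, probReal_univ, one_smul]

end Sampling

section InducedDensity

variable {F : Bigraph} {J₁ J₂ : Type*} {W : J₁ → J₂ → ℝ}

theorem inducedDensityAt_ne_zero_iff {x : F.U₁ → J₁} {y : F.U₂ → J₂} :
    inducedDensityAt F W x y ≠ 0 ↔
      (∀ p ∈ F.E, W (x p.1) (y p.2) ≠ 0) ∧ ∀ p ∉ F.E, W (x p.1) (y p.2) ≠ 1 := by
  simp only [inducedDensityAt, mul_ne_zero_iff, Finset.prod_ne_zero_iff, Finset.mem_compl,
    sub_ne_zero, ne_comm (a := (1 : ℝ))]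

theorem inducedDensityAt_mem_Icc (hW : ∀ x y, W x y ∈ Set.Icc (0 : ℝ) 1) (x : F.U₁ → J₁)
    (y : F.U₂ → J₂) : inducedDensityAt F W x y ∈ Set.Icc (0 : ℝ) 1 := by
  classical
  have hnonneg (p : F.U₁ × F.U₂) : 0 ≤ W (x p.1) (y p.2) := (hW _ _).1
  have hle_one (p : F.U₁ × F.U₂) : W (x p.1) (y p.2) ≤ 1 := (hW _ _).2
  have hcompl_nonneg (p : F.U₁ × F.U₂) : 0 ≤ 1 - W (x p.1) (y p.2) := sub_nonneg.2 (hle_one p)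
  have hprod_nonneg := Finset.prod_nonneg fun p (_ : p ∈ F.Eᶜ) => hcompl_nonneg p
  exact ⟨mul_nonneg (Finset.prod_nonneg fun p _ => hnonneg p) hprod_nonneg,
    mul_le_one₀ (Finset.prod_le_one (fun p _ => hnonneg p) fun p _ => hle_one p) hprod_nonneg
      (Finset.prod_le_one (fun p _ => hcompl_nonneg p) fun p _ => sub_le_self _ (hnonneg p))⟩

/-- The bigraph obtained from `F` by interchanging its two sides. It transfers results about `J₁`
to `J₂`. -/
def Bigraph.swap (F : Bigraph) : Bigraph where
  U₁ := F.U₂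
  U₂ := F.U₁
  E := F.E.map (Equiv.prodComm F.U₁ F.U₂).toEmbedding

theorem Bigraph.numNodes_swap (F : Bigraph) : F.swap.numNodes = F.numNodes :=
  Nat.add_comm _ _

theorem inducedDensityAt_swap (F : Bigraph) (W : J₁ → J₂ → ℝ) (x : F.U₁ → J₁) (y : F.U₂ → J₂) :
    inducedDensityAt F.swap (fun y x => W x y) y x = inducedDensityAt F W x y := by
  unfold inducedDensityAt Bigraph.swap
  congr 1
  · exact Finset.prod_map _ _ _
  · exact Finset.prod_equiv (Equiv.prodComm _ _) (by simp) (by simp)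

variable [MeasurableSpace J₁] [MeasurableSpace J₂] {π₁ : Measure J₁} {π₂ : Measure J₂}
  [IsProbabilityMeasure π₁] [IsProbabilityMeasure π₂]

theorem IsBigraphon.integrable_inducedDensityAt (hW : IsBigraphon π₁ π₂ W) (F : Bigraph) :
    Integrable (fun p : (F.U₁ → J₁) × (F.U₂ → J₂) => inducedDensityAt F W p.1 p.2)
      ((Measure.pi fun _ => π₁).prod (Measure.pi fun _ => π₂)) := by
  classical
  have hW_comp (q : F.U₁ × F.U₂) :
      AEMeasurable (fun p : (F.U₁ → J₁) × (F.U₂ → J₂) => W (p.1 q.1) (p.2 q.2))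
        ((Measure.pi fun _ => π₁).prod (Measure.pi fun _ => π₂)) :=
    hW.aemeasurable.comp_quasiMeasurePreserving
      (measurePreserving_eval_prodMap_eval q.1 q.2).quasiMeasurePreserving
  refine .of_mem_Icc 0 1 ?_ (.of_forall fun p => inducedDensityAt_mem_Icc hW.mem_Icc _ _)
  exact (Finset.aemeasurable_fun_prod _ fun q _ => hW_comp q).mul
    (Finset.aemeasurable_fun_prod _ fun q _ => aemeasurable_const.sub (hW_comp q))

theorem IsBigraphon.ae_inducedDensityAt_eq_zero (hW : IsBigraphon π₁ π₂ W)
    (hF : inducedDensity π₁ π₂ F W = 0) :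
    ∀ᵐ p : (F.U₁ → J₁) × (F.U₂ → J₂) ∂((Measure.pi fun _ => π₁).prod (Measure.pi fun _ => π₂)),
      inducedDensityAt F W p.1 p.2 = 0 := by
  have hint := hW.integrable_inducedDensityAt F
  have hnonneg : 0 ≤ fun p : (F.U₁ → J₁) × (F.U₂ → J₂) => inducedDensityAt F W p.1 p.2 :=
    fun p => (inducedDensityAt_mem_Icc hW.mem_Icc p.1 p.2).1
  exact (integral_eq_zero_iff_of_nonneg hnonneg hint).1 ((integral_prod _ hint).trans hF)

theorem IsBigraphon.ae_eq_zero_or_one (hW : IsBigraphon π₁ π₂ W)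
    (hF : inducedDensity π₁ π₂ F W = 0) : ∀ᵐ p ∂(π₁.prod π₂), W p.1 p.2 = 0 ∨ W p.1 p.2 = 1 := by
  have hfrac : ∀ᵐ p ∂(π₁.prod π₂), p ∉ Function.uncurry W ⁻¹' Set.Ioo 0 1 := by
    refine ae_notMem_of_ae_not_forall_mem (ι := F.U₁) (κ := F.U₂)
      (hW.aemeasurable.nullMeasurable measurableSet_Ioo) ?_
    filter_upwards [hW.ae_inducedDensityAt_eq_zero hF] with p hp hall
    exact inducedDensityAt_ne_zero_iff.2
      ⟨fun e _ => (hall e.1 e.2).1.ne', fun e _ => (hall e.1 e.2).2.ne⟩ hp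
  filter_upwards [hfrac] with p hp
  obtain ⟨hnonneg, hle_one⟩ := hW.mem_Icc p.1 p.2
  by_contra! hne
  exact hp ⟨hnonneg.lt_of_ne hne.1.symm, hle_one.lt_of_ne hne.2⟩

theorem IsBigraphon.inducedDensity_swap (hW : IsBigraphon π₁ π₂ W) (F : Bigraph) :
    inducedDensity π₂ π₁ F.swap (fun y x => W x y) = inducedDensity π₁ π₂ F W :=
  calc inducedDensity π₂ π₁ F.swap (fun y x => W x y)
    _ = ∫ y : F.U₂ → J₂, ∫ x : F.U₁ → J₁, inducedDensityAt F W x y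
          ∂(Measure.pi fun _ => π₁) ∂(Measure.pi fun _ => π₂) := by
        simp only [← inducedDensityAt_swap F W]; rfl
    _ = inducedDensity π₁ π₂ F W :=
        (integral_integral_swap (hW.integrable_inducedDensityAt F)).symm

end InducedDensity

section Separation

variable {F : Bigraph} {J₁ J₂ : Type*} {W : J₁ → J₂ → ℝ}

/-- Sampled nodes `x` and `y` are generic for `F` if `W` takes only the values `0` and `1` on the
sampled grid and no injective choice of nodes in the sample gives `F` a nonzero induced density. The
indices are chosen injectively; the values of `x` and `y` may repeat. -/
structure IsGenericSample {ι κ : Type*} (F : Bigraph) (W : J₁ → J₂ → ℝ) (x : ι → J₁)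
    (y : κ → J₂) : Prop where
  zero_or_one : ∀ i j, W (x i) (y j) = 0 ∨ W (x i) (y j) = 1
  inducedDensityAt_eq_zero : ∀ (f : F.U₁ ↪ ι) (g : F.U₂ ↪ κ),
    inducedDensityAt F W (x ∘ f) (y ∘ g) = 0

theorem IsGenericSample.card_le {ι κ : Type*} [Fintype ι] [Fintype κ] {x : ι → J₁} {y : κ → J₂}
    (h : IsGenericSample F W x y) (hinj : Function.Injective fun i j => W (x i) (y j)) :
    Fintype.card ι ≤ (Fintype.card κ + 1) ^ F.numNodes := by
  classical
  let R (i : ι) : Finset κ := {j | W (x i) (y j) = 1}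
  have mem_R (i : ι) (j : κ) : j ∈ R i ↔ W (x i) (y j) = 1 := by simp [R]
  have hR : Function.Injective R := fun i i' hii' => hinj <| funext fun j => by
    have hone : W (x i) (y j) = 1 ↔ W (x i') (y j) = 1 := by rw [← mem_R, ← mem_R, hii']
    rcases h.zero_or_one i j with hi | hi <;> rcases h.zero_or_one i' j with hi' | hi' <;>
      simp_all
  refine Bigraph.card_le_of_not_isInducedIn hR ?_
  rintro ⟨f, g, hfg⟩
  refine inducedDensityAt_ne_zero_iff.2 ⟨fun p hp => ?_, fun p hp => ?_⟩
    (h.inducedDensityAt_eq_zero f g)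
  · simp [(mem_R _ _).1 ((hfg p.1 p.2).2 hp)]
  · exact fun hone => hp ((hfg p.1 p.2).1 ((mem_R _ _).2 hone))

variable [MeasurableSpace J₂] {π₂ : Measure J₂} [IsProbabilityMeasure π₂]

theorem measureReal_section_eq_le (hsec : ∀ x, AEMeasurable (W x) π₂)
    (hmem : ∀ x y, W x y ∈ Set.Icc (0 : ℝ) 1) (x x' : J₁) :
    π₂.real {z | W x z = W x' z} ≤ 1 - nbhdDist₁ π₂ W x x' := by
  have hle (z : J₂) : |W x z - W x' z| ≤ 1 :=
    Real.dist_le_of_mem_Icc_01 (hmem x z) (hmem x' z)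
  have hint : Integrable (fun z => |W x z - W x' z|) π₂ :=
    .of_mem_Icc 0 1 ((hsec x).sub (hsec x')).abs (.of_forall fun z => ⟨abs_nonneg _, hle z⟩)
  simpa [sub_eq_zero, nbhdDist₁] using measureReal_eq_zero_le_one_sub_integral hint hle

variable [MeasurableSpace J₁] {π₁ : Measure J₁} [IsProbabilityMeasure π₁]

theorem IsBigraphon.ae_isGenericSample {ι κ : Type*} [Fintype ι] [Fintype κ]
    (hW : IsBigraphon π₁ π₂ W) (hF : inducedDensity π₁ π₂ F W = 0) :
    ∀ᵐ p : (ι → J₁) × (κ → J₂) ∂((Measure.pi fun _ => π₁).prod (Measure.pi fun _ => π₂)),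
      IsGenericSample F W p.1 p.2 := by
  have hgrid : ∀ᵐ p : (ι → J₁) × (κ → J₂) ∂((Measure.pi fun _ => π₁).prod (Measure.pi fun _ => π₂)),
      ∀ i j, W (p.1 i) (p.2 j) = 0 ∨ W (p.1 i) (p.2 j) = 1 :=
    ae_all_iff.2 fun i => ae_all_iff.2 fun j =>
      (measurePreserving_eval_prodMap_eval i j).quasiMeasurePreserving.ae
        (hW.ae_eq_zero_or_one hF)
  have hfree : ∀ᵐ p : (ι → J₁) × (κ → J₂) ∂((Measure.pi fun _ => π₁).prod (Measure.pi fun _ => π₂)),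
      ∀ (f : F.U₁ ↪ ι) (g : F.U₂ ↪ κ), inducedDensityAt F W (p.1 ∘ f) (p.2 ∘ g) = 0 :=
    ae_all_iff.2 fun f => ae_all_iff.2 fun g =>
      ((measurePreserving_pi_comp_embedding f).prod
        (measurePreserving_pi_comp_embedding g)).quasiMeasurePreserving.ae
        (hW.ae_inducedDensityAt_eq_zero hF)
  filter_upwards [hgrid, hfree] with p hp hp' using ⟨hp, hp'⟩

variable [PseudoMetricSpace J₁] [π₁.IsOpenPosMeasure]

theorem IsBigraphon.exists_dist_lt_and_ae_isGenericSample {ι κ : Type*} [Fintype ι] [Fintype κ]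
    (hW : IsBigraphon π₁ π₂ W) (hF : inducedDensity π₁ π₂ F W = 0) (x₀ : ι → J₁) {δ : ℝ}
    (hδ : 0 < δ) :
    ∃ x, dist x₀ x < δ ∧ ∀ᵐ y : κ → J₂ ∂(Measure.pi fun _ => π₂), IsGenericSample F W x y := by
  have hdense := Measure.dense_of_ae
    (Measure.ae_ae_of_ae_prod (hW.ae_isGenericSample (ι := ι) (κ := κ) hF))
  obtain ⟨x, hx, hdist⟩ := hdense.exists_dist_lt x₀ hδ
  exact ⟨x, hdist, hx⟩

theorem IsBigraphon.card_le_of_separated (hW : IsBigraphon π₁ π₂ W)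
    (hF : inducedDensity π₁ π₂ F W = 0) (hsec : ∀ x, AEMeasurable (W x) π₂)
    (hdist : ∀ x x', dist x x' ≤ nbhdDist₁ π₂ W x x') {ε : ℝ} (hε : 0 < ε) (hε2 : ε ≤ 2)
    {s : Finset J₁} (hs : (s : Set J₁).Pairwise fun x y => ε ≤ dist x y) {M : ℕ}
    (hM : (s.card : ℝ) ^ 2 * (1 - ε / 2) ^ M < 1) : s.card ≤ (M + 1) ^ F.numNodes := by
  obtain ⟨x, hx_near, hx_generic⟩ := hW.exists_dist_lt_and_ae_isGenericSample (κ := Fin M) hF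
    ((↑) : s → J₁) (show 0 < ε / 4 by positivity)
  have hx_sep (i j : s) (hij : i ≠ j) : ε / 2 ≤ dist (x i) (x j) := by
    have hi : dist (i : J₁) (x i) < ε / 4 := (dist_le_pi_dist _ _ i).trans_lt hx_near
    have hj : dist (j : J₁) (x j) < ε / 4 := (dist_le_pi_dist _ _ j).trans_lt hx_near
    have hij_sep : ε ≤ dist (i : J₁) j := hs i.2 j.2 (Subtype.coe_ne_coe.2 hij)
    have htri := dist_triangle4 (i : J₁) (x i) (x j) j
    rw [dist_comm (x j)] at htri
    linarith
  have hrows : ∃ᵐ y : Fin M → J₂ ∂(Measure.pi fun _ => π₂),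
      Function.Injective fun i j => W (x i) (y j) := by
    refine frequently_injective_sample (f := fun i => W (x i)) (q := 1 - ε / 2) (by linarith)
      (fun i j hij => ?_) (by simpa using hM)
    linarith [measureReal_section_eq_le hsec hW.mem_Icc (x i) (x j), hdist (x i) (x j),
      hx_sep i j hij]
  obtain ⟨y, hy_rows, hy_generic⟩ := (hrows.and_eventually hx_generic).exists
  simpa using hy_generic.card_le hy_rows

end Separation

section Asymptotics

open Real

theorem sq_mul_one_sub_pow_lt_one {a δ : ℝ} {M : ℕ} (ha : 0 < a) (hδ : δ ≤ 1)
    (hM : 2 * log a < δ * M) : a ^ 2 * (1 - δ) ^ M < 1 :=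
  calc a ^ 2 * (1 - δ) ^ M ≤ a ^ 2 * exp (-δ) ^ M :=
        mul_le_mul_of_nonneg_left
          (pow_le_pow_left₀ (sub_nonneg.2 hδ) (one_sub_le_exp_neg δ) M) (sq_nonneg a)
    _ = exp (2 * log a - δ * M) := by
        rw [← exp_nat_mul, ← exp_log (pow_pos ha 2), ← exp_add, log_pow]
        push_cast
        ring_nf
    _ < 1 := by rw [exp_lt_one_iff]; linarith

theorem log_le_of_forall_le_pow {n k : ℕ} (hn : 0 < n) {ε : ℝ} (hε : 0 < ε) (hε1 : ε ≤ 1)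
    (h : ∀ M : ℕ, (n : ℝ) ^ 2 * (1 - ε / 2) ^ M < 1 → n ≤ (M + 1) ^ k) :
    log n ≤ k * (log (1 / ε) + (log 4 + log (log n + 1))) := by
  have hlog : 0 ≤ log n := log_natCast_nonneg n
  have hpos : 0 < log n + 1 := by linarith
  let M := ⌊4 * log n / ε⌋₊ + 1
  have hM_lower : 4 * log n / ε < M := by exact_mod_cast Nat.lt_floor_add_one _
  have hM_upper : (M : ℝ) + 1 ≤ 1 / ε * (4 * (log n + 1)) :=
    calc (M : ℝ) + 1 ≤ 4 * log n / ε + 1 + 1 := by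
          push_cast [M]; gcongr; exact Nat.floor_le (by positivity)
      _ ≤ 4 * log n / ε + 4 / ε := by linarith [one_le_div hε |>.2 hε1, div_eq_mul_one_div 4 ε]
      _ = 1 / ε * (4 * (log n + 1)) := by ring
  have hn_le : n ≤ (M + 1) ^ k := by
    refine h M (sq_mul_one_sub_pow_lt_one (by exact_mod_cast hn) (by linarith) ?_)
    rw [div_lt_iff₀ hε] at hM_lower
    linarith
  calc log n ≤ log (((M : ℝ) + 1) ^ k) :=
        log_le_log (by exact_mod_cast hn) (by exact_mod_cast hn_le)
    _ = k * log ((M : ℝ) + 1) := log_pow _ _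
    _ ≤ k * log (1 / ε * (4 * (log n + 1))) := by gcongr
    _ = k * (log (1 / ε) + (log 4 + log (log n + 1))) := by
        rw [log_mul (by positivity) (by positivity), log_mul (by positivity) hpos.ne']

theorem eventually_mul_add_log_le (k c : ℝ) {δ : ℝ} (hδ : 0 < δ) :
    ∀ᶠ L in atTop, k * (c + log (L + 1)) ≤ δ * L := by
  have hconst : (fun _ : ℝ => c) =o[atTop] (id : ℝ → ℝ) :=
    Asymptotics.isLittleO_const_id_atTop c
  have hlog : (fun L : ℝ => log (L + 1)) =o[atTop] (id : ℝ → ℝ) := by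
    have hshift : (fun L : ℝ => log (L + 1)) =o[atTop] fun L => L + 1 :=
      isLittleO_log_id_atTop.comp_tendsto (tendsto_atTop_add_const_right _ 1 tendsto_id)
    exact hshift.trans_isBigO ((Asymptotics.isBigO_refl _ _).add
      (Asymptotics.isLittleO_const_id_atTop 1).isBigO)
  filter_upwards [((hconst.add hlog).const_mul_left k).bound hδ, eventually_ge_atTop 0]
    with L hL hL0
  simpa [abs_of_nonneg hL0] using (le_abs_self _).trans hL

theorem eventually_forall_le_mul_of_le_mul_add_log {k d : ℝ} (c : ℝ) (hk : 0 ≤ k) (hkd : k < d) :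
    ∀ᶠ t in atTop, ∀ L, L ≤ k * (t + (c + log (L + 1))) → L ≤ d * t := by
  have hd : 0 < d := hk.trans_lt hkd
  have hgap : 0 < 1 - k / d := sub_pos.2 ((div_lt_one hd).2 hkd)
  have hsmall := (eventually_mul_add_log_le k c (half_pos hgap)).and (eventually_gt_atTop 0)
  filter_upwards [(tendsto_id.const_mul_atTop hd).eventually_forall_ge_atTop hsmall]
    with t ht L hL
  by_contra! hlt
  obtain ⟨hlog, hLpos⟩ := ht L hlt.le
  have hkt : k * t ≤ k / d * L := by
    rw [div_mul_eq_mul_div, le_div_iff₀ hd]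
    nlinarith
  linarith [mul_pos hgap hLpos]

theorem tendsto_log_one_div_nhdsGT_zero :
    Tendsto (fun ε : ℝ => log (1 / ε)) (𝓝[>] 0) atTop := by
  simpa only [one_div, Function.comp_def] using tendsto_log_atTop.comp tendsto_inv_nhdsGT_zero

end Asymptotics

section PackingDimension

variable {X : Type*} [MetricSpace X]

theorem log_sepNumber_le {ε b : ℝ}
    (h : ∀ s : Finset X, s.Nonempty → (s : Set X).Pairwise (fun x y => ε ≤ dist x y) →
      Real.log s.card ≤ b) :
    ENNReal.log (sepNumber X ε : ENNReal) ≤ b := by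
  have hsep : sepNumber X ε ≤ (⌊Real.exp b⌋₊ : ℕ∞) := iSup₂_le fun s hs => by
    rcases s.eq_empty_or_nonempty with rfl | hne
    · simp
    · have hcard : (0 : ℝ) < s.card := by exact_mod_cast hne.card_pos
      exact_mod_cast Nat.le_floor ((Real.log_le_iff_le_exp hcard).1 (h s hne hs))
  calc ENNReal.log (sepNumber X ε : ENNReal)
    _ ≤ ENNReal.log (ENNReal.ofReal (Real.exp b)) := by
        refine ENNReal.log_monotone ((ENat.toENNReal_le.2 hsep).trans ?_)
        rw [ENat.toENNReal_coe, ← ENNReal.ofReal_natCast]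
        exact ENNReal.ofReal_le_ofReal (Nat.floor_le (Real.exp_pos b).le)
    _ = b := by rw [ENNReal.log_ofReal_of_pos (Real.exp_pos b), Real.log_exp]

theorem upperPackingDim_le_of_forall_gt {k : ℝ}
    (h : ∀ d > k, ∀ᶠ ε : ℝ in 𝓝[>] 0, ∀ s : Finset X, s.Nonempty →
      (s : Set X).Pairwise (fun x y => ε ≤ dist x y) → Real.log s.card ≤ d * Real.log (1 / ε)) :
    upperPackingDim X ≤ k := by
  refine EReal.le_of_forall_lt_iff_le.1 fun d hd => limsup_le_of_le (by isBoundedDefault) ?_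
  filter_upwards [h d (EReal.coe_lt_coe_iff.1 hd),
    tendsto_log_one_div_nhdsGT_zero.eventually_gt_atTop 0] with ε hε hlog
  rw [EReal.div_le_iff_le_mul (by exact_mod_cast hlog) (EReal.coe_ne_top _), mul_comm]
  exact log_sepNumber_le hε

theorem eventually_sepNumber_ne_top (h : upperPackingDim X < ⊤) :
    ∀ᶠ ε in 𝓝[>] 0, sepNumber X ε ≠ ⊤ := by
  filter_upwards [eventually_lt_of_limsup_lt h,
    tendsto_log_one_div_nhdsGT_zero.eventually_gt_atTop 0] with ε hε hlog htop
  rw [htop, ENat.toENNReal_top, ENNReal.log_top,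
    EReal.top_div_of_pos_ne_top (by exact_mod_cast hlog) (EReal.coe_ne_top _)] at hε
  exact hε.false

theorem packingNumber_univ_le_sepNumber (ε : NNReal) :
    Metric.packingNumber ε (Set.univ : Set X) ≤ sepNumber X ε := by
  refine iSup₂_le fun C _ => iSup_le fun hC => ENat.forall_natCast_le_iff_le.1 fun n hn => ?_
  obtain ⟨t, htC, ht⟩ := Set.exists_subset_encard_eq hn
  have ht_fin : t.Finite := Set.finite_of_encard_eq_coe ht
  have ht_sep : (ht_fin.toFinset : Set X).Pairwise fun x y => (ε : ℝ) ≤ dist x y := by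
    rw [ht_fin.coe_toFinset]
    intro x hx y hy hxy
    have hlt : (ε : ENNReal) < edist x y := hC (htC hx) (htC hy) hxy
    rw [edist_nndist, ENNReal.coe_lt_coe] at hlt
    exact hlt.le
  rw [← ht, ht_fin.encard_eq_coe_toFinset_card]
  exact le_iSup₂_of_le ht_fin.toFinset ht_sep le_rfl

theorem totallyBounded_univ_of_upperPackingDim_lt_top (h : upperPackingDim X < ⊤) :
    TotallyBounded (Set.univ : Set X) := by
  refine Metric.totallyBounded_iff.2 fun r hr => ?_
  obtain ⟨ε, hε_fin, hε_pos, hεr⟩ :=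
    ((eventually_sepNumber_ne_top h).and (Ioo_mem_nhdsGT hr)).exists
  lift ε to NNReal using hε_pos.le
  have hcover : Metric.coveringNumber ε (Set.univ : Set X) ≠ ⊤ :=
    (((Metric.coveringNumber_le_packingNumber _ _).trans
      (packingNumber_univ_le_sepNumber ε)).trans_lt hε_fin.lt_top).ne
  exact ⟨Metric.minimalCover ε Set.univ, Metric.finite_minimalCover,
    (Metric.isCover_iff_subset_iUnion_closedBall.1 (Metric.isCover_minimalCover hcover)).trans
      (Set.iUnion₂_mono fun _ _ => Metric.closedBall_subset_ball hεr)⟩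

theorem compactSpace_of_upperPackingDim_lt_top [CompleteSpace X] (h : upperPackingDim X < ⊤) :
    CompactSpace X :=
  isCompact_univ_iff.1 <|
    (totallyBounded_univ_of_upperPackingDim_lt_top h).isCompact_of_isClosed isClosed_univ

end PackingDimension

section PureBigraphon

variable {F : Bigraph} {J₁ J₂ : Type*} [MeasurableSpace J₁] [MeasurableSpace J₂] [MetricSpace J₁]
  {π₁ : Measure J₁} {π₂ : Measure J₂} [IsProbabilityMeasure π₁] [IsProbabilityMeasure π₂]
  {W : J₁ → J₂ → ℝ}

theorem IsBigraphon.upperPackingDim_le [π₁.IsOpenPosMeasure] (hW : IsBigraphon π₁ π₂ W)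
    (hF : inducedDensity π₁ π₂ F W = 0) (hsec : ∀ x, AEMeasurable (W x) π₂)
    (hdist : ∀ x x', dist x x' ≤ nbhdDist₁ π₂ W x x') : upperPackingDim J₁ ≤ F.numNodes := by
  refine upperPackingDim_le_of_forall_gt (k := F.numNodes) fun d hd => ?_
  filter_upwards [tendsto_log_one_div_nhdsGT_zero.eventually
      (eventually_forall_le_mul_of_le_mul_add_log (Real.log 4) (Nat.cast_nonneg _) hd),
    Ioc_mem_nhdsGT one_pos] with ε hdim hε s hne hs
  exact hdim _ <| log_le_of_forall_le_pow hne.card_pos hε.1 hε.2 fun M hM =>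
    hW.card_le_of_separated hF hsec hdist hε.1 (hε.2.trans one_le_two) hs hM

variable [MetricSpace J₂]

theorem IsPureBigraphon.swap (hW : IsPureBigraphon π₁ π₂ W) :
    IsPureBigraphon π₂ π₁ fun y x => W x y where
  aemeasurable := hW.aemeasurable.prod_swap
  mem_Icc y x := hW.mem_Icc x y
  section₁ := hW.section₂
  section₂ := hW.section₁
  dist_eq₁ := hW.dist_eq₂
  dist_eq₂ := hW.dist_eq₁
  complete₁ := hW.complete₂
  complete₂ := hW.complete₁
  separable₁ := hW.separable₂
  separable₂ := hW.separable₁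
  full_support₁ := hW.full_support₂
  full_support₂ := hW.full_support₁

theorem IsPureBigraphon.upperPackingDim_le₁ (hW : IsPureBigraphon π₁ π₂ W)
    (hF : inducedDensity π₁ π₂ F W = 0) : upperPackingDim J₁ ≤ F.numNodes :=
  have : π₁.IsOpenPosMeasure := ⟨fun U hU hne => (hW.full_support₁ U hU hne).ne'⟩
  hW.toIsBigraphon.upperPackingDim_le hF hW.section₁ fun x x' => (hW.dist_eq₁ x x').le

theorem IsPureBigraphon.upperPackingDim_le₂ (hW : IsPureBigraphon π₁ π₂ W)
    (hF : inducedDensity π₁ π₂ F W = 0) : upperPackingDim J₂ ≤ F.numNodes := by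
  rw [← F.numNodes_swap]
  exact hW.swap.upperPackingDim_le₁ ((hW.inducedDensity_swap F).trans hF)

end PureBigraphon

theorem theorem3p6 {J₁ J₂ : Type*} [MeasurableSpace J₁] [MeasurableSpace J₂]
    [MetricSpace J₁] [MetricSpace J₂]
    (π₁ : Measure J₁) (π₂ : Measure J₂) [IsProbabilityMeasure π₁] [IsProbabilityMeasure π₂]
    (W : J₁ → J₂ → ℝ) (hW : IsPureBigraphon π₁ π₂ W) (hthin : IsThin π₁ π₂ W) :
    (∀ᵐ p ∂(π₁.prod π₂), W p.1 p.2 = 0 ∨ W p.1 p.2 = 1) ∧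
    (CompactSpace J₁ ∧ CompactSpace J₂) ∧
    (upperPackingDim J₁ < ⊤ ∧ upperPackingDim J₂ < ⊤) ∧
    (∀ F : Bigraph, inducedDensity π₁ π₂ F W = 0 →
      upperPackingDim J₁ ≤ ((10 * F.numNodes : ℕ) : EReal) ∧
      upperPackingDim J₂ ≤ ((10 * F.numNodes : ℕ) : EReal)) := by
  obtain ⟨F₀, hF₀⟩ := hthin
  have := hW.complete₁
  have := hW.complete₂
  have hfin₁ : upperPackingDim J₁ < ⊤ := (hW.upperPackingDim_le₁ hF₀).trans_lt (EReal.coe_lt_top _)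
  have hfin₂ : upperPackingDim J₂ < ⊤ := (hW.upperPackingDim_le₂ hF₀).trans_lt (EReal.coe_lt_top _)
  refine ⟨hW.ae_eq_zero_or_one hF₀, ⟨compactSpace_of_upperPackingDim_lt_top hfin₁,
    compactSpace_of_upperPackingDim_lt_top hfin₂⟩, ⟨hfin₁, hfin₂⟩, fun F hF => ?_⟩
  have hk : (F.numNodes : EReal) ≤ ((10 * F.numNodes : ℕ) : EReal) := by
    exact_mod_cast Nat.le_mul_of_pos_left F.numNodes (by norm_num)
  exact ⟨(hW.upperPackingDim_le₁ hF).trans hk, (hW.upperPackingDim_le₂ hF).trans hk⟩
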